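/- Let $\mathcal X,\mathcal Y\subseteq\mathbb C^n$ be subspaces with $\dim\mathcal X=p$, $\dim\mathcal Y=q$ and put $m=\min(p,q)$. The principal angles $\Theta(\mathcal X,\mathcal Y)=[\theta_1,\dots,\theta_m]$, $\theta_k\in[0,\pi/2]$, are defined recursively by $$\cos\theta_k=\max_{x\in\mathcal X}\max_{y\in\mathcal Y}|x^Hy|=|x_k^Hy_k|\quad\text{subject to } \|x\|=\|y\|=1,\ x^Hx_i=0,\ y^Hy_i=0\ (i=1,\dots,k-1),$$ where $(x_k,y_k)$ is any pair at which the maximum is attained; so $\theta_1\le\dots\le\theta_m$. Put $\tan(\pi/2)=\infty$. **Theorem 4.1.** Let $P_{\mathcal X}$, $P_{\mathcal X^\perp}$ and $P_{\mathcal Y}$ be the orthogonal projectors onto $\mathcal X$, $\mathcal X^\perp$ and $\mathcal Y$, and let $T=P_{\mathcal X^\perp}\left(P_{\mathcal X}P_{\mathcal Y}\right)^{\dagger}$, where $^\dagger$ is the Moore–Penrose pseudoinverse. Let $S_+(T)$ be the vector of positive singular values of $T$, repeated according to multiplicity, in decreasing order. Then the tangents of the principal angles between $\mathcal X$ and $\mathcal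 Y$, in decreasing order, are $$[\tan\theta_m,\dots,\tan\theta_1]=[\infty,\dots,\infty,\,S_+(T),\,0,\dots,0],$$ with exactly $\min\left(\dim(\mathcal X^\perp\cap\mathcal Y),\dim(\mathcal X\cap\mathcal Y^\perp)\right)$ entries $\infty$ in front of $S_+(T)$ and exactly $\dim(\mathcal X\cap\mathcal Y)$ zeros after it. In particular the two vectors have the same length $m$. -/

import Mathlib

namespace PABS

section Pseudoinverse

/-- `B` satisfies the four Moore-Penrose equations for `A`:
`A B A = A`, `B A B = B`, `(A B)ᴴ = A B`, `(B A)ᴴ = B A`. -/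
structure IsPseudoinverse {E F : Type*}
    [NormedAddCommGroup E] [InnerProductSpace ℂ E] [FiniteDimensional ℂ E]
    [NormedAddCommGroup F] [InnerProductSpace ℂ F] [FiniteDimensional ℂ F]
    (A : E →ₗ[ℂ] F) (B : F →ₗ[ℂ] E) : Prop where
  mul_inv_mul : A ∘ₗ B ∘ₗ A = A
  inv_mul_inv : B ∘ₗ A ∘ₗ B = B
  adjoint_mul_inv : LinearMap.adjoint (A ∘ₗ B) = A ∘ₗ B
  adjoint_inv_mul : LinearMap.adjoint (B ∘ₗ A) = B ∘ₗ A

theorem IsPseudoinverse.unique {E F : Type*}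
    [NormedAddCommGroup E] [InnerProductSpace ℂ E] [FiniteDimensional ℂ E]
    [NormedAddCommGroup F] [InnerProductSpace ℂ F] [FiniteDimensional ℂ F]
    {A : E →ₗ[ℂ] F} {B C : F →ₗ[ℂ] E}
    (hB : IsPseudoinverse A B) (hC : IsPseudoinverse A C) : B = C := by
  have h1 : A ∘ₗ B = A ∘ₗ C := by
    calc A ∘ₗ B = LinearMap.adjoint (A ∘ₗ B) := hB.adjoint_mul_inv.symm
      _ = LinearMap.adjoint ((A ∘ₗ C) ∘ₗ (A ∘ₗ B)) := by
          congr 1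
          conv_lhs => rw [← hC.mul_inv_mul]
          rfl
      _ = (A ∘ₗ B) ∘ₗ (A ∘ₗ C) := by
          rw [LinearMap.adjoint_comp, hB.adjoint_mul_inv, hC.adjoint_mul_inv]
      _ = (A ∘ₗ B ∘ₗ A) ∘ₗ C := rfl
      _ = A ∘ₗ C := by rw [hB.mul_inv_mul]
  have h2 : B ∘ₗ A = C ∘ₗ A := by
    calc B ∘ₗ A = LinearMap.adjoint (B ∘ₗ A) := hB.adjoint_inv_mul.symm
      _ = LinearMap.adjoint ((B ∘ₗ A) ∘ₗ (C ∘ₗ A)) := by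
          congr 1
          conv_lhs => rw [← hC.mul_inv_mul]
          rfl
      _ = (C ∘ₗ A) ∘ₗ (B ∘ₗ A) := by
          rw [LinearMap.adjoint_comp, hB.adjoint_inv_mul, hC.adjoint_inv_mul]
      _ = C ∘ₗ (A ∘ₗ B ∘ₗ A) := rfl
      _ = C ∘ₗ A := by rw [hB.mul_inv_mul]
  calc B = B ∘ₗ (A ∘ₗ B) := hB.inv_mul_inv.symm
    _ = (B ∘ₗ A) ∘ₗ C := by rw [h1]; rfl
    _ = C ∘ₗ A ∘ₗ C := by rw [h2]; rfl
    _ = C := hC.inv_mul_inv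

theorem exists_isPseudoinverse {E F : Type*}
    [NormedAddCommGroup E] [InnerProductSpace ℂ E] [FiniteDimensional ℂ E]
    [NormedAddCommGroup F] [InnerProductSpace ℂ F] [FiniteDimensional ℂ F]
    (A : E →ₗ[ℂ] F) : ∃ B : F →ₗ[ℂ] E, IsPseudoinverse A B := by
  have hc : IsCompl (LinearMap.ker A)ᗮ (LinearMap.ker A) :=
    (Submodule.isCompl_orthogonal (LinearMap.ker A)).symm
  let e := A.kerComplementEquivRange hc
  have he : ∀ z, (e z : F) = A z := fun z => rfl
  let R := LinearMap.range A
  let K := (LinearMap.ker A)ᗮ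
  let B : F →ₗ[ℂ] E :=
    K.subtype ∘ₗ e.symm.toLinearMap ∘ₗ (R.orthogonalProjectionOnto : F →ₗ[ℂ] R)
  have hAB : A ∘ₗ B = (R.starProjection : F →ₗ[ℂ] F) := by
    ext y
    change A (e.symm (R.orthogonalProjectionOnto y) : E) = _
    rw [← he, LinearEquiv.apply_symm_apply]
    rfl
  have hBA : B ∘ₗ A = (K.starProjection : E →ₗ[ℂ] E) := by
    ext x
    have h1 : A (K.starProjection x) = A x := by
      have h := K.sub_starProjection_mem_orthogonal x
      rw [Submodule.orthogonal_orthogonal, LinearMap.mem_ker, map_sub, sub_eq_zero] at h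
      exact h.symm
    have h2 : R.orthogonalProjectionOnto (A x) = e (K.orthogonalProjectionOnto x) := by
      apply Subtype.ext
      rw [he]
      have : R.starProjection (A x) = A x :=
        Submodule.starProjection_eq_self_iff.mpr (LinearMap.mem_range_self A x)
      exact this.trans h1.symm
    change ((e.symm (R.orthogonalProjectionOnto (A x)) : K) : E) = _
    rw [h2, LinearEquiv.symm_apply_apply]
    rfl
  have hadj : ∀ U : Submodule ℂ E,
      LinearMap.adjoint (U.starProjection : E →ₗ[ℂ] E) = (U.starProjection : E →ₗ[ℂ] E) :=
    fun U => (LinearMap.isSymmetric_iff_isSelfAdjoint _).mp U.starProjection_isSymmetric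
  have hadj' : ∀ U : Submodule ℂ F,
      LinearMap.adjoint (U.starProjection : F →ₗ[ℂ] F) = (U.starProjection : F →ₗ[ℂ] F) :=
    fun U => (LinearMap.isSymmetric_iff_isSelfAdjoint _).mp U.starProjection_isSymmetric
  refine ⟨B, ?_, ?_, ?_, ?_⟩
  · rw [← LinearMap.comp_assoc, hAB]
    ext x
    exact Submodule.starProjection_eq_self_iff.mpr (LinearMap.mem_range_self A x)
  · rw [← LinearMap.comp_assoc, hBA]
    ext y
    exact Submodule.starProjection_eq_self_iff.mpr
      (e.symm (R.orthogonalProjectionOnto y)).2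
  · rw [hAB, hadj']
  · rw [hBA, hadj]

/-- The Moore-Penrose pseudoinverse `A†`: the unique solution of the four Penrose equations. -/
noncomputable def pinv {E F : Type*}
    [NormedAddCommGroup E] [InnerProductSpace ℂ E] [FiniteDimensional ℂ E]
    [NormedAddCommGroup F] [InnerProductSpace ℂ F] [FiniteDimensional ℂ F]
    (A : E →ₗ[ℂ] F) : F →ₗ[ℂ] E :=
  (exists_isPseudoinverse A).choose

theorem isPseudoinverse_pinv {E F : Type*}
    [NormedAddCommGroup E] [InnerProductSpace ℂ E] [FiniteDimensional ℂ E]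
    [NormedAddCommGroup F] [InnerProductSpace ℂ F] [FiniteDimensional ℂ F]
    (A : E →ₗ[ℂ] F) : IsPseudoinverse A (pinv A) :=
  (exists_isPseudoinverse A).choose_spec

end Pseudoinverse

/-- The orthogonal projector onto a subspace, as a linear operator on the whole space. -/
noncomputable def proj {E : Type*} [NormedAddCommGroup E] [InnerProductSpace ℂ E]
    [FiniteDimensional ℂ E] (U : Submodule ℂ E) : E →ₗ[ℂ] E :=
  (U.starProjection : E →ₗ[ℂ] E)

/-- The positive singular values `S₊(T)`, with multiplicity, in decreasing order. -/
noncomputable def posSingularValues {E F : Type*}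
    [NormedAddCommGroup E] [InnerProductSpace ℂ E] [FiniteDimensional ℂ E]
    [NormedAddCommGroup F] [InnerProductSpace ℂ F] [FiniteDimensional ℂ F]
    (T : E →ₗ[ℂ] F) : List ℝ :=
  ((List.range (Module.finrank ℂ E)).map fun i => T.singularValues i).filter
    fun s => decide (0 < s)

section PrincipalAngles

/-- The pairs `(u, v)` of unit vectors `u ∈ X`, `v ∈ Y` such that `u` is orthogonal to the
previously chosen `x i`, and `v` to the previously chosen `y i`, for `i < k`. -/
def admissiblePairs {E : Type*} [NormedAddCommGroup E] [InnerProductSpace ℂ E]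
    (X Y : Submodule ℂ E) {m : ℕ} (x y : Fin m → E) (k : Fin m) : Set (E × E) :=
  {p | p.1 ∈ X ∧ p.2 ∈ Y ∧ ‖p.1‖ = 1 ∧ ‖p.2‖ = 1 ∧
    ∀ i < k, inner ℂ p.1 (x i) = 0 ∧ inner ℂ p.2 (y i) = 0}

/-- `θ = [θ₁, …, θₘ]`, `m = min (dim X) (dim Y)`, is the vector of principal angles between
`X` and `Y`, defined recursively: `θ k ∈ [0, π/2]`, and `cos (θ k)` is the maximum of
`|uᴴ v|` over the admissible pairs, attained at the pair `(x k, y k)` of principal vectors. -/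
def IsPrincipalAngles {E : Type*} [NormedAddCommGroup E] [InnerProductSpace ℂ E]
    (X Y : Submodule ℂ E)
    (θ : Fin (min (Module.finrank ℂ X) (Module.finrank ℂ Y)) → ℝ) : Prop :=
  ∃ x y : Fin (min (Module.finrank ℂ X) (Module.finrank ℂ Y)) → E, ∀ k,
    θ k ∈ Set.Icc 0 (Real.pi / 2) ∧
    (x k, y k) ∈ admissiblePairs X Y x y k ∧
    Real.cos (θ k) = ‖inner ℂ (x k) (y k)‖ ∧
    ∀ p ∈ admissiblePairs X Y x y k, ‖inner ℂ p.1 p.2‖ ≤ Real.cos (θ k)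

theorem exists_unit_mem_orthogonal {E : Type*} [NormedAddCommGroup E] [InnerProductSpace ℂ E]
    [FiniteDimensional ℂ E] (X : Submodule ℂ E) (j : ℕ) (x : ℕ → E)
    (hj : j < Module.finrank ℂ X) :
    ∃ u ∈ X, ‖u‖ = 1 ∧ ∀ i < j, inner ℂ u (x i) = 0 := by
  let L : X →ₗ[ℂ] (Fin j → ℂ) := LinearMap.pi fun i =>
    (innerSL ℂ (x i) : E →ₗ[ℂ] ℂ) ∘ₗ X.subtype
  obtain ⟨w, hw, hw0⟩ : ∃ w ∈ LinearMap.ker L, w ≠ 0 := by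
    apply Submodule.exists_mem_ne_zero_of_ne_bot
    apply LinearMap.ker_ne_bot_of_finrank_lt
    simpa using hj
  have hn : ‖(w : E)‖ ≠ 0 := by simpa using hw0
  refine ⟨((‖(w : E)‖⁻¹ : ℝ) : ℂ) • (w : E), X.smul_mem _ w.2, ?_, ?_⟩
  · rw [norm_smul]
    simp [hn]
  · intro i hi
    have h : inner ℂ (x i) (w : E) = 0 := congrFun (LinearMap.mem_ker.mp hw) ⟨i, hi⟩
    rw [inner_smul_left, inner_eq_zero_symm.mp h, mul_zero]

/-- Principal angles exist for any two subspaces. -/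
theorem exists_isPrincipalAngles {E : Type*} [NormedAddCommGroup E] [InnerProductSpace ℂ E]
    [FiniteDimensional ℂ E] (X Y : Submodule ℂ E) : ∃ θ, IsPrincipalAngles X Y θ := by
  let adm (x y : ℕ → E) (k : ℕ) : Set (E × E) :=
    {p | p.1 ∈ X ∧ p.2 ∈ Y ∧ ‖p.1‖ = 1 ∧ ‖p.2‖ = 1 ∧
      ∀ i < k, inner ℂ p.1 (x i) = 0 ∧ inner ℂ p.2 (y i) = 0}
  have key : ∀ j ≤ min (Module.finrank ℂ X) (Module.finrank ℂ Y), ∃ x y : ℕ → E, ∀ k < j,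
      (x k, y k) ∈ adm x y k ∧
      ∀ p ∈ adm x y k, ‖inner ℂ p.1 p.2‖ ≤ ‖inner ℂ (x k) (y k)‖ := by
    intro j
    induction j with
    | zero => exact fun _ => ⟨0, 0, fun k hk => absurd hk (Nat.not_lt_zero k)⟩
    | succ j ih =>
      intro hj
      obtain ⟨x, y, hxy⟩ := ih (by omega)
      have hjX : j < Module.finrank ℂ X := by omega
      have hjY : j < Module.finrank ℂ Y := by omega
      obtain ⟨u, huX, hu1, hu⟩ := exists_unit_mem_orthogonal X j x hjX
      obtain ⟨v, hvY, hv1, hv⟩ := exists_unit_mem_orthogonal Y j y hjY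
      have hne : (adm x y j).Nonempty :=
        ⟨(u, v), huX, hvY, hu1, hv1, fun i hi => ⟨hu i hi, hv i hi⟩⟩
      have : ProperSpace E := FiniteDimensional.proper ℂ E
      have hclosed : IsClosed (adm x y j) := by
        have hX : IsClosed (X : Set E) := X.closed_of_finiteDimensional
        have hY : IsClosed (Y : Set E) := Y.closed_of_finiteDimensional
        refine (hX.preimage continuous_fst).inter ((hY.preimage continuous_snd).inter
          ((isClosed_eq (by fun_prop) (by fun_prop)).inter
          ((isClosed_eq (by fun_prop) (by fun_prop)).inter ?_)))
        have : {p : E × E | ∀ i < j, inner ℂ p.1 (x i) = 0 ∧ inner ℂ p.2 (y i) = 0} =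
            ⋂ i, ⋂ (_ : i < j), ({p : E × E | inner ℂ p.1 (x i) = 0} ∩
              {p : E × E | inner ℂ p.2 (y i) = 0}) := by
          ext p; simp
        change IsClosed {p : E × E | ∀ i < j, inner ℂ p.1 (x i) = 0 ∧ inner ℂ p.2 (y i) = 0}
        rw [this]
        exact isClosed_iInter fun i => isClosed_iInter fun _ =>
          (isClosed_eq (by fun_prop) (by fun_prop)).inter
            (isClosed_eq (by fun_prop) (by fun_prop))
      have hcpt : IsCompact (adm x y j) := by
        apply Metric.isCompact_of_isClosed_isBounded hclosed
        refine (Metric.isBounded_closedBall (x := (0 : E × E)) (r := 1)).subset ?_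
        intro p hp
        rw [mem_closedBall_zero_iff, Prod.norm_def]
        exact max_le hp.2.2.1.le hp.2.2.2.1.le
      obtain ⟨q, hq, hmax⟩ := hcpt.exists_isMaxOn hne
        (f := fun p : E × E => ‖inner ℂ p.1 p.2‖) (by fun_prop)
      have hupd : ∀ k ≤ j, adm (Function.update x j q.1) (Function.update y j q.2) k =
          adm x y k := by
        intro k hk
        ext p
        have h : ∀ i < k, i ≠ j := fun i hi => by omega
        constructor
        · rintro ⟨h1, h2, h3, h4, h5⟩
          refine ⟨h1, h2, h3, h4, fun i hi => ?_⟩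
          simpa [Function.update_of_ne (h i hi)] using h5 i hi
        · rintro ⟨h1, h2, h3, h4, h5⟩
          refine ⟨h1, h2, h3, h4, fun i hi => ?_⟩
          simpa [Function.update_of_ne (h i hi)] using h5 i hi
      refine ⟨Function.update x j q.1, Function.update y j q.2, fun k hk => ?_⟩
      rw [hupd k (by omega)]
      rcases Nat.lt_succ_iff_lt_or_eq.mp hk with h | rfl
      · simpa [Function.update_of_ne h.ne] using hxy k h
      · simpa using And.intro hq fun a b hab => hmax hab
  obtain ⟨x, y, hxy⟩ := key _ le_rfl
  have hadm : ∀ k : Fin (min (Module.finrank ℂ X) (Module.finrank ℂ Y)),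
      admissiblePairs X Y (fun i => x i) (fun i => y i) k = adm x y k := by
    intro k
    ext p
    constructor
    · rintro ⟨h1, h2, h3, h4, h5⟩
      exact ⟨h1, h2, h3, h4, fun i hi => h5 ⟨i, hi.trans k.2⟩ hi⟩
    · rintro ⟨h1, h2, h3, h4, h5⟩
      exact ⟨h1, h2, h3, h4, fun i hi => h5 i hi⟩
  refine ⟨fun k => Real.arccos ‖inner ℂ (x k) (y k)‖, fun i => x i, fun i => y i, fun k => ?_⟩
  obtain ⟨h1, h2⟩ := hxy k k.2
  have hcos : Real.cos (Real.arccos ‖inner ℂ (x k) (y k)‖) = ‖inner ℂ (x k) (y k)‖ := by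
    apply Real.cos_arccos
    · linarith [norm_nonneg (inner ℂ (x k) (y k))]
    · refine (norm_inner_le_norm (x k) (y k)).trans ?_
      rw [show ‖x k‖ = 1 from h1.2.2.1, show ‖y k‖ = 1 from h1.2.2.2.1, mul_one]
  rw [hadm k]
  exact ⟨⟨Real.arccos_nonneg _, Real.arccos_le_pi_div_two.mpr (norm_nonneg _)⟩, h1, hcos,
    fun p hp => (h2 p hp).trans hcos.ge⟩

end PrincipalAngles

/-- The tangent of an angle in `[0, π/2]`, with the value `∞` at `π/2`. -/
noncomputable def extTan (t : ℝ) : EReal :=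
  if t = Real.pi / 2 then ⊤ else ((Real.tan t : ℝ) : EReal)

end PABS

/-! Write `s_k = ⟨x_k, y_k⟩`, so `|s_k| = cos θ_k`. Optimality of each pair forces `P_X y_k = s_k
x_k` and `P_Y x_k = conj s_k y_k` (`starProjection_eq_smul_of_isMax`). Since one of the two families
exhausts its space, the rest of `X` is orthogonal to `Y` and conversely. These facts form
`IsPrincipalSystem`, and everything else is read off from them.

The operator `A = P_X P_Y` sends `y_k` to `s_k x_k`, so `A†` sends `x_k` to `s_k⁻¹ y_k` (to `0` if
`s_k = 0`) and kills the complement of the `x_k`. Hence the vectors `T x_k = s_k⁻¹ (y_k - s_k x_k)`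
are pairwise orthogonal, of squared norm `(1 - |s_k|²)/|s_k|² = tan² θ_k` when `s_k ≠ 0`, and
`S₊(T)` consists of the finite positive tangents (`coe_posSingularValues`).

The two ends are dimension counts. The `x_k` with `|s_k| = 1` span `X ∩ Y` (`finrank_inf_eq`). Those
with `s_k ≠ 0` span the complement of `X ∩ Yᗮ` in `X`, and likewise for `Y` (`finrank_left_eq`),
which counts the right angles. -/

namespace PABS

/-! ### Singular values from an orthogonal image of an orthonormal family -/

section SingularValues

variable {E F : Type*}
  [NormedAddCommGroup E] [InnerProductSpace ℂ E] [FiniteDimensional ℂ E]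
  [NormedAddCommGroup F] [InnerProductSpace ℂ F] [FiniteDimensional ℂ F]

/-- If `T` maps an orthonormal basis to pairwise orthogonal vectors, then its singular values are
the norms of these vectors. -/
theorem coe_map_singularValues_eq {ι : Type*} [Fintype ι] [DecidableEq ι] (T : E →ₗ[ℂ] F)
    (b : OrthonormalBasis ι ℂ E) (t : ι → ℝ) (ht : ∀ i, 0 ≤ t i)
    (h : ∀ i j, inner ℂ (T (b i)) (T (b j)) = if i = j then ((t i ^ 2 : ℝ) : ℂ) else 0) :
    (((List.range (Module.finrank ℂ E)).map fun i => T.singularValues i : List ℝ) : Multiset ℝ) =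
      Finset.univ.val.map t := by
  have hsymm := T.isSymmetric_adjoint_comp_self
  have hdiag : LinearMap.toMatrix b.toBasis b.toBasis (LinearMap.adjoint T ∘ₗ T) =
      Matrix.diagonal fun i => ((t i ^ 2 : ℝ) : ℂ) := by
    ext i j
    rw [LinearMap.toMatrix_apply, Matrix.diagonal_apply, ← h, OrthonormalBasis.coe_toBasis,
      OrthonormalBasis.coe_toBasis_repr_apply, OrthonormalBasis.repr_apply_apply,
      LinearMap.comp_apply, LinearMap.adjoint_inner_right]
  have hroots : (LinearMap.adjoint T ∘ₗ T).charpoly.roots =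
      Finset.univ.val.map fun i => ((t i ^ 2 : ℝ) : ℂ) := by
    rw [← LinearMap.charpoly_toMatrix _ b.toBasis, hdiag, Matrix.charpoly_diagonal,
      Polynomial.roots_prod _ _ (Finset.prod_ne_zero_iff.mpr fun i _ => Polynomial.X_sub_C_ne_zero _)]
    simp only [Polynomial.roots_X_sub_C, Multiset.bind_singleton]
  rw [hsymm.roots_charpoly_eq_eigenvalues rfl] at hroots
  -- The roots are complex numbers with real values `t i ^ 2`; `√ ∘ re` turns eigenvalues of `T* T`
  -- back into singular values.
  have h2 := congrArg (Multiset.map fun z : ℂ => √z.re) hroots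
  rw [Multiset.map_map, Multiset.map_map] at h2
  calc _ = Finset.univ.val.map fun i : Fin (Module.finrank ℂ E) => T.singularValues i := by
        rw [Fin.univ_val_map, List.ofFn_eq_map, ← List.map_coe_finRange_eq_range, List.map_map]
        rfl
    _ = Finset.univ.val.map t := by
        convert h2 using 2
        · rw [T.singularValues_fin rfl]
          rfl
        · simp [-Complex.ofReal_pow, Real.sqrt_sq (ht _)]

/-- If `T` maps an orthonormal family to pairwise orthogonal vectors, and vanishes on its orthogonal
complement, then its positive singular values are the positive norms of these vectors. -/
theorem coe_posSingularValues_eq {ι : Type*} [Fintype ι] [DecidableEq ι] (T : E →ₗ[ℂ] F)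
    {x : ι → E} (hx : Orthonormal ℂ x) (t : ι → ℝ) (ht : ∀ i, 0 ≤ t i)
    (h : ∀ i j, inner ℂ (T (x i)) (T (x j)) = if i = j then ((t i ^ 2 : ℝ) : ℂ) else 0)
    (h0 : ∀ z, (∀ i, inner ℂ (x i) z = 0) → T z = 0) :
    (posSingularValues T : Multiset ℝ) = (Finset.univ.val.map t).filter (0 < ·) := by
  -- Completing `x` by a basis of its orthogonal complement only adds zero singular values, which
  -- the filter removes.
  let K := (Submodule.span ℂ (Set.range x))ᗮ
  let w := stdOrthonormalBasis ℂ K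
  have hxw : ∀ i j, inner ℂ (x i) (w j : E) = 0 := fun i j =>
    (Submodule.mem_orthogonal _ _).mp (w j).2 _ (Submodule.subset_span ⟨i, rfl⟩)
  have hTw : ∀ j, T (w j) = 0 := fun j => h0 _ fun i => hxw i j
  have hw : Orthonormal ℂ fun j => (w j : E) := w.orthonormal.comp_linearIsometry K.subtypeₗᵢ
  have hv : Orthonormal ℂ (Sum.elim x fun j => (w j : E)) := by
    rw [orthonormal_iff_ite] at hx hw ⊢
    rintro (i | i) (j | j)
    · simpa using hx i j
    · simpa using hxw i j
    · simpa using inner_eq_zero_symm.mp (hxw j i)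
    · simpa using hw i j
  have hbot : (Submodule.span ℂ (Set.range (Sum.elim x fun j => (w j : E))))ᗮ = ⊥ := by
    rw [eq_bot_iff]
    intro z hz
    rw [Submodule.mem_orthogonal] at hz
    have hzK : z ∈ K := by
      refine Submodule.orthogonal_le (Submodule.span_mono ?_) ((Submodule.mem_orthogonal _ _).mpr hz)
      rintro _ ⟨i, rfl⟩
      exact ⟨Sum.inl i, rfl⟩
    have : (⟨z, hzK⟩ : K) = 0 := by
      apply w.repr.injective
      ext j
      rw [w.repr_apply_apply, map_zero]
      exact hz (w j) (Submodule.subset_span ⟨Sum.inr j, rfl⟩)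
    simpa using this
  let b := OrthonormalBasis.mkOfOrthogonalEqBot hv hbot
  have hb : ∀ i, b i = Sum.elim x (fun j => (w j : E)) i := fun i =>
    congrFun (OrthonormalBasis.coe_of_orthogonal_eq_bot_mk hv hbot) i
  have key := coe_map_singularValues_eq T b (Sum.elim t fun _ => 0)
    (by rintro (i | i) <;> simp [ht]) (by
      rintro (i | i) (j | j)
      · simpa [hb] using h i j
      · simp [hb, hTw]
      · simp [hb, hTw]
      · simp [hb, hTw])
  have hfilter : (posSingularValues T : Multiset ℝ) =
      ((((List.range (Module.finrank ℂ E)).map fun i => T.singularValues i : List ℝ) :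
        Multiset ℝ)).filter (0 < ·) := by
    rw [Multiset.filter_coe]
    rfl
  rw [hfilter, key, ← Finset.univ_disjSum_univ, Finset.val_disjSum, Multiset.disjSum,
    Multiset.map_add, Multiset.filter_add, Multiset.map_map, Multiset.map_map]
  simpa [Function.comp_def, Multiset.filter_eq_nil] using
    fun a ha => (Multiset.eq_of_mem_replicate ha).le

end SingularValues

/-! ### Consequences of the Penrose equations -/

section Pseudoinverse

variable {E F : Type*}
  [NormedAddCommGroup E] [InnerProductSpace ℂ E] [FiniteDimensional ℂ E]
  [NormedAddCommGroup F] [InnerProductSpace ℂ F] [FiniteDimensional ℂ F]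
  {A : E →ₗ[ℂ] F} {B : F →ₗ[ℂ] E}

/-- Take adjoints in `A B A = A` and use that `B A` is self-adjoint. -/
theorem IsPseudoinverse.apply_apply_adjoint (h : IsPseudoinverse A B) (z : F) :
    B (A (LinearMap.adjoint A z)) = LinearMap.adjoint A z := by
  have h1 := congrArg LinearMap.adjoint h.mul_inv_mul
  rw [LinearMap.adjoint_comp, h.adjoint_inv_mul] at h1
  exact LinearMap.congr_fun h1 z

/-- `A B = (A B)* = B* A*` kills `z`, and `B = B A B`. -/
theorem IsPseudoinverse.apply_eq_zero (h : IsPseudoinverse A B) {z : F}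
    (hz : LinearMap.adjoint A z = 0) : B z = 0 := by
  have h1 : A (B z) = 0 := by
    rw [← LinearMap.comp_apply, ← h.adjoint_mul_inv, LinearMap.adjoint_comp, LinearMap.comp_apply,
      hz, map_zero]
  rw [← h.inv_mul_inv, LinearMap.comp_apply, LinearMap.comp_apply, h1, map_zero]

variable (X Y : Submodule ℂ E)

theorem adjoint_proj : LinearMap.adjoint (proj X) = proj X :=
  (LinearMap.isSymmetric_iff_isSelfAdjoint _).mp X.starProjection_isSymmetric

theorem adjoint_proj_comp_proj :
    LinearMap.adjoint (proj X ∘ₗ proj Y) = proj Y ∘ₗ proj X := by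
  rw [LinearMap.adjoint_comp, adjoint_proj, adjoint_proj]

end Pseudoinverse

/-! ### The extended tangent -/

section Tangent

theorem extTan_zero : extTan 0 = 0 := by
  rw [extTan, if_neg (by positivity), Real.tan_zero, EReal.coe_zero]

theorem extTan_monotoneOn : MonotoneOn extTan (Set.Icc 0 (Real.pi / 2)) := by
  intro a ha b hb hab
  unfold extTan
  by_cases h : b = Real.pi / 2
  · simp [h]
  · have hb' : b < Real.pi / 2 := lt_of_le_of_ne hb.2 h
    rw [if_neg h, if_neg (hab.trans_lt hb').ne, EReal.coe_le_coe_iff]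
    have hpi := Real.pi_pos
    exact Real.strictMonoOn_tan.monotoneOn ⟨by linarith [ha.1], by linarith⟩
      ⟨by linarith [hb.1], hb'⟩ hab

/-- Angles strictly inside the interval have positive tangent. The filter drops both endpoints,
because `Real.tan (π / 2) = 0`. -/
theorem map_extTan_eq (s : Multiset ℝ) (hs : ∀ a ∈ s, a ∈ Set.Icc 0 (Real.pi / 2)) :
    s.map extTan = Multiset.replicate (s.count (Real.pi / 2)) ⊤ +
      ((s.map Real.tan).filter (0 < ·)).map (fun a : ℝ => (a : EReal)) +
      Multiset.replicate (s.count 0) 0 := by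
  have hpi := Real.pi_pos
  induction s using Multiset.induction with
  | empty => simp
  | cons a s ih =>
    have ha := hs a (Multiset.mem_cons_self a s)
    have ih := ih fun c hc => hs c (Multiset.mem_cons_of_mem hc)
    rw [Multiset.map_cons, Multiset.map_cons, ih]
    by_cases h1 : a = Real.pi / 2
    · have h0 : a ≠ 0 := by rw [h1]; positivity
      rw [Multiset.filter_cons_of_neg _ (by rw [h1, Real.tan_pi_div_two]; exact lt_irrefl 0),
        h1, Multiset.count_cons_self, Multiset.count_cons_of_ne (h1 ▸ h0.symm),
        Multiset.replicate_succ]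
      simp [extTan]
    by_cases h0 : a = 0
    · subst h0
      rw [Multiset.filter_cons_of_neg _ (by rw [Real.tan_zero]; exact lt_irrefl 0),
        Multiset.count_cons_self, Multiset.count_cons_of_ne (Ne.symm h1),
        Multiset.replicate_succ, extTan_zero]
      simp
    · have hpos : 0 < Real.tan a :=
        Real.tan_pos_of_pos_of_lt_pi_div_two (lt_of_le_of_ne ha.1 (Ne.symm h0))
          (lt_of_le_of_ne ha.2 h1)
      rw [Multiset.filter_cons_of_pos _ hpos, Multiset.count_cons_of_ne (Ne.symm h1),
        Multiset.count_cons_of_ne (Ne.symm h0)]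
      simp [extTan, h1]

end Tangent

end PABS

/-! ### Principal systems -/

namespace PABS

/-- `x` and `y` are orthonormal families in `X` and `Y` that are biorthogonal under the two
projections, and the parts of `X` and `Y` orthogonal to them are orthogonal to `Y` and `X`. -/
structure IsPrincipalSystem {E : Type*} [NormedAddCommGroup E] [InnerProductSpace ℂ E]
    [FiniteDimensional ℂ E] {ι : Type*} (X Y : Submodule ℂ E) (x y : ι → E) : Prop where
  mem_left : ∀ k, x k ∈ X
  mem_right : ∀ k, y k ∈ Y
  orthonormal_left : Orthonormal ℂ x
  orthonormal_right : Orthonormal ℂ y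
  proj_left : ∀ k, X.starProjection (y k) = inner ℂ (x k) (y k) • x k
  proj_right : ∀ k, Y.starProjection (x k) = inner ℂ (y k) (x k) • y k
  perp_left : ∀ u ∈ X, (∀ k, inner ℂ (x k) u = 0) → u ∈ Yᗮ
  perp_right : ∀ v ∈ Y, (∀ k, inner ℂ (y k) v = 0) → v ∈ Xᗮ

theorem eq_zero_of_mem_span {E : Type*} [NormedAddCommGroup E] [InnerProductSpace ℂ E]
    {ι : Type*} {x : ι → E} {u : E} (hu : u ∈ Submodule.span ℂ (Set.range x))
    (h : ∀ k, inner ℂ (x k) u = 0) : u = 0 := by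
  have h1 : u ∈ (Submodule.span ℂ (Set.range x))ᗮ := by
    rw [Submodule.mem_orthogonal]
    intro w hw
    induction hw using Submodule.span_induction with
    | mem w hw => obtain ⟨k, rfl⟩ := hw; exact h k
    | zero => exact inner_zero_left _
    | add a b _ _ ha hb => rw [inner_add_left, ha, hb, add_zero]
    | smul c a _ ha => rw [inner_smul_left, ha, mul_zero]
  exact inner_self_eq_zero.mp ((Submodule.mem_orthogonal _ _).mp h1 u hu)

variable {E : Type*} [NormedAddCommGroup E] [InnerProductSpace ℂ E] [FiniteDimensional ℂ E]
  {ι : Type*} {X Y : Submodule ℂ E} {x y : ι → E}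

theorem inner_starProjection_of_mem {u : E} (hu : u ∈ X) (v : E) :
    inner ℂ u (X.starProjection v) = inner ℂ u v := by
  rw [← X.inner_starProjection_left_eq_right, Submodule.starProjection_eq_self_iff.mpr hu]

/-- Equality case of Cauchy–Schwarz: by Pythagoras the component of the projection orthogonal to `u`
has norm zero. -/
theorem starProjection_eq_smul {u v : E} (hu : u ∈ X) (hu1 : ‖u‖ = 1)
    (h : ‖X.starProjection v‖ ≤ ‖inner ℂ u v‖) :
    X.starProjection v = inner ℂ u v • u := by
  rw [← inner_starProjection_of_mem hu v] at h ⊢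
  generalize X.starProjection v = w at h ⊢
  have h1 : inner ℂ (inner ℂ u w • u) (w - inner ℂ u w • u) = 0 := by
    rw [inner_smul_left, inner_sub_right, inner_smul_right, inner_self_eq_norm_sq_to_K, hu1]
    simp
  have h2 := norm_add_sq_eq_norm_sq_add_norm_sq_of_inner_eq_zero _ _ h1
  rw [add_sub_cancel, norm_smul, hu1, mul_one] at h2
  have h3 : ‖w - inner ℂ u w • u‖ = 0 := by
    nlinarith [norm_nonneg w, norm_nonneg (w - inner ℂ u w • u)]
  exact sub_eq_zero.mp (norm_eq_zero.mp h3)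

theorem span_range_eq_of_card_eq [Fintype ι] (hx : ∀ k, x k ∈ X) (ho : Orthonormal ℂ x)
    (hc : Fintype.card ι = Module.finrank ℂ X) : Submodule.span ℂ (Set.range x) = X := by
  apply Submodule.eq_of_le_of_finrank_eq
  · rw [Submodule.span_le]
    rintro _ ⟨k, rfl⟩
    exact hx k
  · rw [finrank_span_eq_card ho.linearIndependent, hc]

/-- If `x` exhausts `X`, then `u = 0`. If `y` exhausts `Y`, then `⟨y_k, u⟩` is a multiple of `⟨x_k,
u⟩ = 0`, so `P_Y u = 0`. -/
theorem mem_orthogonal_of_card_eq [Fintype ι] (hx : ∀ k, x k ∈ X) (hy : ∀ k, y k ∈ Y)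
    (hxo : Orthonormal ℂ x) (hyo : Orthonormal ℂ y)
    (hp : ∀ k, X.starProjection (y k) = inner ℂ (x k) (y k) • x k)
    (hc : Fintype.card ι = Module.finrank ℂ X ∨ Fintype.card ι = Module.finrank ℂ Y)
    {u : E} (hu : u ∈ X) (h : ∀ k, inner ℂ (x k) u = 0) : u ∈ Yᗮ := by
  rcases hc with hc | hc
  · rw [← span_range_eq_of_card_eq hx hxo hc] at hu
    rw [eq_zero_of_mem_span hu h]
    exact Submodule.zero_mem _
  · have h0 : ∀ k, inner ℂ (y k) (Y.starProjection u) = 0 := by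
      intro k
      rw [inner_starProjection_of_mem (hy k), ← inner_conj_symm,
        ← inner_starProjection_of_mem hu, hp, inner_smul_right, ← inner_conj_symm u, h k]
      simp
    have h1 := Y.starProjection_apply_mem u
    rw [← span_range_eq_of_card_eq hy hyo hc] at h1
    exact (Y.starProjection_apply_eq_zero_iff).mp (eq_zero_of_mem_span
      (by rwa [← span_range_eq_of_card_eq hy hyo hc]) h0)

namespace IsPrincipalSystem

theorem symm (h : IsPrincipalSystem X Y x y) : IsPrincipalSystem Y X y x :=
  ⟨h.mem_right, h.mem_left, h.orthonormal_right, h.orthonormal_left, h.proj_right, h.proj_left,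
    h.perp_right, h.perp_left⟩

theorem inner_left_right_of_ne (h : IsPrincipalSystem X Y x y) {i j : ι} (hij : i ≠ j) :
    inner ℂ (x i) (y j) = 0 := by
  rw [← inner_starProjection_of_mem (h.mem_left i), h.proj_left, inner_smul_right,
    h.orthonormal_left.2 hij, mul_zero]

theorem inner_right_left_of_mem (h : IsPrincipalSystem X Y x y) (k : ι) {u : E} (hu : u ∈ X) :
    inner ℂ (y k) u = inner ℂ (y k) (x k) * inner ℂ (x k) u := by
  rw [← inner_conj_symm, ← inner_starProjection_of_mem hu, h.proj_left, inner_smul_right, map_mul,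
    inner_conj_symm, inner_conj_symm]

/-- The `x`-expansion of `u ∈ X` determines `u` up to a vector orthogonal to `Y`. -/
theorem mem_orthogonal_of_inner_eq_zero [Fintype ι] [DecidableEq ι]
    (h : IsPrincipalSystem X Y x y) {u : E} (hu : u ∈ X)
    (h0 : ∀ k, inner ℂ (x k) (y k) ≠ 0 → inner ℂ (x k) u = 0) : u ∈ Yᗮ := by
  have hterm : ∀ k, inner ℂ (x k) u • x k ∈ Yᗮ := by
    intro k
    by_cases hk : inner ℂ (x k) (y k) = 0
    · apply Submodule.smul_mem
      rw [← Y.starProjection_apply_eq_zero_iff, h.proj_right, inner_eq_zero_symm.mp hk, zero_smul]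
    · rw [h0 k hk, zero_smul]
      exact Submodule.zero_mem _
  have hrest : u - ∑ k, inner ℂ (x k) u • x k ∈ Yᗮ := by
    apply h.perp_left
    · exact X.sub_mem hu (X.sum_mem fun k _ => X.smul_mem _ (h.mem_left k))
    · intro k
      rw [inner_sub_right, h.orthonormal_left.inner_right_fintype, sub_self]
  have := Yᗮ.add_mem hrest (Yᗮ.sum_mem (t := Finset.univ) fun k _ => hterm k)
  rwa [sub_add_cancel] at this

/-- Inside `X`, the orthogonal complement of the `x_k` with `s_k ≠ 0` is exactly `X ∩ Yᗮ`. -/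
theorem finrank_left_eq [Fintype ι] [DecidableEq ι] (h : IsPrincipalSystem X Y x y) :
    Module.finrank ℂ X = Nat.card {k // inner ℂ (x k) (y k) ≠ 0} +
      Module.finrank ℂ (X ⊓ Yᗮ : Submodule ℂ E) := by
  classical
  let x' : {k // inner ℂ (x k) (y k) ≠ 0} → E := fun k => x k
  have ho : Orthonormal ℂ x' := h.orthonormal_left.comp _ Subtype.val_injective
  have hle : Submodule.span ℂ (Set.range x') ≤ X := by
    rw [Submodule.span_le]
    rintro _ ⟨k, rfl⟩
    exact h.mem_left k
  have heq : (Submodule.span ℂ (Set.range x'))ᗮ ⊓ X = X ⊓ Yᗮ := by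
    ext u
    simp only [Submodule.mem_inf]
    constructor
    · rintro ⟨h1, h2⟩
      refine ⟨h2, h.mem_orthogonal_of_inner_eq_zero h2 fun k hk => ?_⟩
      exact (Submodule.mem_orthogonal _ _).mp h1 _ (Submodule.subset_span ⟨⟨k, hk⟩, rfl⟩)
    · rintro ⟨h1, h2⟩
      refine ⟨?_, h1⟩
      rw [Submodule.mem_orthogonal]
      intro w hw
      induction hw using Submodule.span_induction with
      | mem w hw =>
        obtain ⟨k, rfl⟩ := hw
        have h3 := h.inner_right_left_of_mem k h1
        rw [(Submodule.mem_orthogonal _ _).mp h2 _ (h.mem_right k)] at h3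
        exact (mul_eq_zero.mp h3.symm).resolve_left fun h4 => k.2 (inner_eq_zero_symm.mp h4)
      | zero => exact inner_zero_left _
      | add a b _ _ ha hb => rw [inner_add_left, ha, hb, add_zero]
      | smul c a _ ha => rw [inner_smul_left, ha, mul_zero]
  rw [← Submodule.finrank_add_inf_finrank_orthogonal hle, heq,
    finrank_span_eq_card ho.linearIndependent, Nat.card_eq_fintype_card]

theorem finrank_inf_eq [Fintype ι] [DecidableEq ι] (h : IsPrincipalSystem X Y x y) :
    Module.finrank ℂ (X ⊓ Y : Submodule ℂ E) = Nat.card {k // ‖inner ℂ (x k) (y k)‖ = 1} := by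
  classical
  let x' : {k // ‖inner ℂ (x k) (y k)‖ = 1} → E := fun k => x k
  have ho : Orthonormal ℂ x' := h.orthonormal_left.comp _ Subtype.val_injective
  have hmem : ∀ k, x' k ∈ X ⊓ Y := by
    refine fun k => ⟨h.mem_left k, ?_⟩
    change x k ∈ Y
    rw [Y.mem_iff_norm_starProjection, h.proj_right, norm_smul, h.orthonormal_left.1,
      h.orthonormal_right.1, norm_inner_symm, k.2, mul_one]
  have heq : Submodule.span ℂ (Set.range x') = X ⊓ Y := by
    apply le_antisymm
    · rw [Submodule.span_le]
      rintro _ ⟨k, rfl⟩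
      exact hmem k
    · rintro u hu
      -- For `u` in both spaces the two expansion formulas combine to `⟨x_k, u⟩ = |s_k|² ⟨x_k, u⟩`.
      have hzero : ∀ k, ‖inner ℂ (x k) (y k)‖ ≠ 1 → inner ℂ (x k) u = 0 := by
        intro k hk
        have h1 := h.inner_right_left_of_mem k hu.1
        rw [h.symm.inner_right_left_of_mem k hu.2] at h1 ⊢
        by_contra hne
        have h2 : inner ℂ (y k) (x k) * inner ℂ (x k) (y k) = 1 := by
          have : inner ℂ (y k) u ≠ 0 := right_ne_zero_of_mul hne
          apply mul_right_cancel₀ this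
          rw [mul_assoc, ← h1, one_mul]
        have h3 := congrArg norm h2
        rw [norm_mul, norm_one, norm_inner_symm] at h3
        apply hk
        nlinarith [norm_nonneg (inner ℂ (x k) (y k))]
      have hsum : ∑ k, inner ℂ (x' k) u • x' k ∈ Submodule.span ℂ (Set.range x') :=
        Submodule.sum_mem _ fun k _ => Submodule.smul_mem _ _ (Submodule.subset_span ⟨k, rfl⟩)
      have hdiff : u - ∑ k, inner ℂ (x' k) u • x' k ∈ X ⊓ Y :=
        Submodule.sub_mem _ hu (Submodule.sum_mem _ fun k _ => Submodule.smul_mem _ _ (hmem k))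
      -- The remainder lies in `Y` and is orthogonal to every `x_k`, hence to `Y`; so it vanishes.
      have hperp : u - ∑ k, inner ℂ (x' k) u • x' k ∈ Yᗮ := by
        refine h.perp_left _ hdiff.1 fun k => ?_
        by_cases hk : ‖inner ℂ (x k) (y k)‖ = 1
        · rw [inner_sub_right]
          exact sub_eq_zero.mpr
            (ho.inner_right_fintype (fun j => inner ℂ (x' j) u) ⟨k, hk⟩).symm
        · rw [inner_sub_right, hzero k hk, inner_sum, Finset.sum_eq_zero, sub_zero]
          intro j _
          have hkj : k ≠ j := by
            rintro rfl
            exact hk j.2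
          rw [inner_smul_right, h.orthonormal_left.2 hkj, mul_zero]
      have h0 := inner_self_eq_zero.mp ((Submodule.mem_orthogonal _ _).mp hperp _ hdiff.2)
      rw [sub_eq_zero.mp h0]
      exact hsum
  rw [← heq, finrank_span_eq_card ho.linearIndependent, Nat.card_eq_fintype_card]

theorem proj_comp_pinv_apply (h : IsPrincipalSystem X Y x y) (k : ι) :
    (proj Xᗮ ∘ₗ pinv (proj X ∘ₗ proj Y)) (x k) =
      (inner ℂ (x k) (y k))⁻¹ • (y k - inner ℂ (x k) (y k) • x k) := by
  have hP := isPseudoinverse_pinv (proj X ∘ₗ proj Y)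
  have hX : proj X (x k) = x k := Submodule.starProjection_eq_self_iff.mpr (h.mem_left k)
  have hY : proj Y (y k) = y k := Submodule.starProjection_eq_self_iff.mpr (h.mem_right k)
  have hA : (proj X ∘ₗ proj Y) (y k) = inner ℂ (x k) (y k) • x k := by
    rw [LinearMap.comp_apply, hY]
    exact h.proj_left k
  have hA' : LinearMap.adjoint (proj X ∘ₗ proj Y) (x k) = inner ℂ (y k) (x k) • y k := by
    rw [adjoint_proj_comp_proj, LinearMap.comp_apply, hX]
    exact h.proj_right k
  have hB : pinv (proj X ∘ₗ proj Y) (x k) = (inner ℂ (x k) (y k))⁻¹ • y k := by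
    by_cases hs : inner ℂ (x k) (y k) = 0
    · rw [hs, inv_zero, zero_smul]
      apply hP.apply_eq_zero
      rw [hA', inner_eq_zero_symm.mp hs, zero_smul]
    · have hs' : inner ℂ (y k) (x k) ≠ 0 := fun h0 => hs (inner_eq_zero_symm.mp h0)
      -- With `A* x_k = conj s_k y_k` and `A y_k = s_k x_k` this reads `conj s_k s_k A† x_k = conj
      -- s_k y_k`.
      have h1 := hP.apply_apply_adjoint (x k)
      rw [hA', map_smul, map_smul, hA, map_smul] at h1
      exact (eq_inv_smul_iff₀ hs).mpr (smul_right_injective E hs' h1)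
  rw [LinearMap.comp_apply, hB, map_smul, proj]
  congr 1
  rw [← h.proj_left k, ContinuousLinearMap.coe_coe, Submodule.starProjection_orthogonal_val]

/-- `P_X z` is still orthogonal to every `x_k`, so it lies in `Yᗮ`; thus `A* z = P_Y P_X z = 0`, and
`A†` vanishes on `ker A*`. -/
theorem proj_comp_pinv_apply_eq_zero (h : IsPrincipalSystem X Y x y) {z : E}
    (hz : ∀ k, inner ℂ (x k) z = 0) : (proj Xᗮ ∘ₗ pinv (proj X ∘ₗ proj Y)) z = 0 := by
  rw [LinearMap.comp_apply, (isPseudoinverse_pinv _).apply_eq_zero, map_zero]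
  rw [adjoint_proj_comp_proj, LinearMap.comp_apply]
  apply (Y.starProjection_apply_eq_zero_iff).mpr
  exact h.perp_left _ (X.starProjection_apply_mem z) fun k => by
    rw [proj, ContinuousLinearMap.coe_coe, inner_starProjection_of_mem (h.mem_left k), hz]

theorem inner_sub_smul (h : IsPrincipalSystem X Y x y) [DecidableEq ι] (i j : ι) :
    inner ℂ (y i - inner ℂ (x i) (y i) • x i) (y j - inner ℂ (x j) (y j) • x j) =
      if i = j then ((1 - ‖inner ℂ (x i) (y i)‖ ^ 2 : ℝ) : ℂ) else 0 := by
  have hx := orthonormal_iff_ite.mp h.orthonormal_left i j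
  have hy := orthonormal_iff_ite.mp h.orthonormal_right i j
  rw [inner_sub_left, inner_sub_right, inner_sub_right, inner_smul_left, inner_smul_left,
    inner_smul_right, inner_smul_right, hx, hy]
  split_ifs with hij
  · subst hij
    rw [mul_one, sub_self, sub_zero, ← inner_conj_symm (y i) (x i), Complex.mul_conj']
    push_cast
    rfl
  · rw [h.inner_left_right_of_ne hij, h.symm.inner_left_right_of_ne hij]
    simp

theorem coe_posSingularValues [Fintype ι] [DecidableEq ι] (h : IsPrincipalSystem X Y x y)
    {θ : ι → ℝ} (hθ : ∀ k, θ k ∈ Set.Icc 0 (Real.pi / 2))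
    (hcos : ∀ k, Real.cos (θ k) = ‖inner ℂ (x k) (y k)‖) :
    (posSingularValues (proj Xᗮ ∘ₗ pinv (proj X ∘ₗ proj Y)) : Multiset ℝ) =
      (Finset.univ.val.map fun k => Real.tan (θ k)).filter (0 < ·) := by
  apply coe_posSingularValues_eq _ h.orthonormal_left
  · exact fun k => Real.tan_nonneg_of_nonneg_of_le_pi_div_two (hθ k).1 (hθ k).2
  · intro i j
    rw [h.proj_comp_pinv_apply, h.proj_comp_pinv_apply, inner_smul_left, inner_smul_right,
      h.inner_sub_smul]
    split_ifs with hij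
    · subst hij
      -- No case split at right angles: both sides are then `0`, as division by zero gives `0`.
      rw [← mul_assoc, Complex.conj_mul', norm_inv, ← hcos, Real.tan_eq_sin_div_cos, div_pow,
        Real.sin_sq]
      push_cast
      ring
    · simp
  · exact fun z hz => h.proj_comp_pinv_apply_eq_zero hz

end IsPrincipalSystem

end PABS

/-! ### Maximizing pairs form a principal system -/

namespace PABS

section PrincipalVectors

variable {E : Type*} [NormedAddCommGroup E] [InnerProductSpace ℂ E] {X Y : Submodule ℂ E}

theorem admissiblePairs_swap {m : ℕ} {x y : Fin m → E} {k : Fin m} {p : E × E}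
    (hp : p ∈ admissiblePairs Y X y x k) : p.swap ∈ admissiblePairs X Y x y k :=
  ⟨hp.2.1, hp.1, hp.2.2.2.1, hp.2.2.1, fun i hi => (hp.2.2.2.2 i hi).symm⟩

/-- The admissible sets shrink with the index, so the maxima decrease, and cosine is strictly
decreasing on `[0, π]`. -/
theorem IsPrincipalAngles.monotone
    {θ : Fin (min (Module.finrank ℂ X) (Module.finrank ℂ Y)) → ℝ}
    (hθ : IsPrincipalAngles X Y θ) : Monotone θ := by
  obtain ⟨x, y, h⟩ := hθ
  intro i j hij
  have hpi := Real.pi_pos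
  have hle : Real.cos (θ j) ≤ Real.cos (θ i) := by
    rw [(h j).2.2.1]
    obtain ⟨h1, h2, h3, h4, h5⟩ := (h j).2.1
    exact (h i).2.2.2 (x j, y j) ⟨h1, h2, h3, h4, fun l hl => h5 l (hl.trans_le hij)⟩
  by_contra hlt
  have := Real.cos_lt_cos_of_nonneg_of_le_pi_div_two (h j).1.1 (h i).1.2 (not_le.mp hlt)
  exact absurd hle (not_le.mpr this)

variable [FiniteDimensional ℂ E]

/-- A maximizing pair `(x k, y k)` is critical: if each earlier `x i` projects onto `Y` along `y i`,
then `y k` projects onto `X` along `x k`. -/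
theorem starProjection_eq_smul_of_isMax {m : ℕ} {x y : Fin m → E} {k : Fin m}
    (hk : (x k, y k) ∈ admissiblePairs X Y x y k)
    (hmax : ∀ p ∈ admissiblePairs X Y x y k, ‖inner ℂ p.1 p.2‖ ≤ ‖inner ℂ (x k) (y k)‖)
    (hmem : ∀ i < k, x i ∈ X)
    (hprev : ∀ i < k, Y.starProjection (x i) = inner ℂ (y i) (x i) • y i) :
    X.starProjection (y k) = inner ℂ (x k) (y k) • x k := by
  obtain ⟨hxX, hyY, hx1, hy1, ho⟩ := hk
  apply starProjection_eq_smul hxX hx1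
  set w := X.starProjection (y k) with hw
  by_cases hw0 : w = 0
  · rw [hw0, norm_zero]
    exact norm_nonneg _
  have hn : ‖w‖ ≠ 0 := norm_ne_zero_iff.mpr hw0
  have hwX : w ∈ X := X.starProjection_apply_mem _
  have hww : inner ℂ w (y k) = ((‖w‖ : ℝ) : ℂ) ^ 2 := by
    rw [← inner_starProjection_of_mem hwX, ← hw]
    exact inner_self_eq_norm_sq_to_K w
  -- The normalized projection of `y k` is itself a competitor: `⟨x i, w⟩ = ⟨x i, y k⟩` is a
  -- multiple of `⟨y i, y k⟩ = 0`. Its pairing with `y k` has modulus `‖w‖`.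
  have hadm : (((‖w‖⁻¹ : ℝ) : ℂ) • w, y k) ∈ admissiblePairs X Y x y k := by
    refine ⟨X.smul_mem _ hwX, hyY, ?_, hy1, fun i hi => ⟨?_, (ho i hi).2⟩⟩
    · rw [norm_smul]
      simp [hn]
    · rw [inner_smul_left, ← inner_conj_symm, hw, inner_starProjection_of_mem (hmem i hi),
        ← inner_conj_symm, ← inner_starProjection_of_mem hyY, hprev i hi, inner_smul_right,
        (ho i hi).2]
      simp
  have h1 := hmax _ hadm
  rw [inner_smul_left, hww, norm_mul, norm_pow, RCLike.norm_conj, Complex.norm_real,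
    Complex.norm_real, norm_inv, norm_norm, pow_two, inv_mul_cancel_left₀ hn] at h1
  exact h1

theorem isPrincipalSystem_of_isMax
    {x y : Fin (min (Module.finrank ℂ X) (Module.finrank ℂ Y)) → E}
    (hadm : ∀ k, (x k, y k) ∈ admissiblePairs X Y x y k)
    (hmax : ∀ k, ∀ p ∈ admissiblePairs X Y x y k,
      ‖inner ℂ p.1 p.2‖ ≤ ‖inner ℂ (x k) (y k)‖) :
    IsPrincipalSystem X Y x y := by
  have hx : ∀ k, x k ∈ X := fun k => (hadm k).1
  have hy : ∀ k, y k ∈ Y := fun k => (hadm k).2.1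
  have hox : Orthonormal ℂ x := by
    refine ⟨fun k => (hadm k).2.2.1, fun i j hij => ?_⟩
    rcases lt_or_gt_of_ne hij with h | h
    · exact inner_eq_zero_symm.mp ((hadm j).2.2.2.2 i h).1
    · exact ((hadm i).2.2.2.2 j h).1
  have hoy : Orthonormal ℂ y := by
    refine ⟨fun k => (hadm k).2.2.2.1, fun i j hij => ?_⟩
    rcases lt_or_gt_of_ne hij with h | h
    · exact inner_eq_zero_symm.mp ((hadm j).2.2.2.2 i h).2
    · exact ((hadm i).2.2.2.2 j h).2
  -- Both formulas are proved in one strong induction, as each needs the other at earlier indices.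
  have hproj : ∀ k, X.starProjection (y k) = inner ℂ (x k) (y k) • x k ∧
      Y.starProjection (x k) = inner ℂ (y k) (x k) • y k := by
    intro k
    induction k using WellFoundedLT.induction with
    | ind k ih =>
      refine ⟨starProjection_eq_smul_of_isMax (hadm k) (hmax k) (fun i _ => hx i)
        fun i hi => (ih i hi).2, ?_⟩
      refine starProjection_eq_smul_of_isMax (admissiblePairs_swap (hadm k)) (fun p hp => ?_)
        (fun i _ => hy i) fun i hi => (ih i hi).1
      rw [norm_inner_symm, norm_inner_symm (y k)]
      exact hmax k _ (admissiblePairs_swap hp)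
  have hcard : Fintype.card (Fin (min (Module.finrank ℂ X) (Module.finrank ℂ Y))) =
      Module.finrank ℂ X ∨ Fintype.card (Fin (min (Module.finrank ℂ X) (Module.finrank ℂ Y))) =
      Module.finrank ℂ Y := by
    rw [Fintype.card_fin]
    omega
  exact ⟨hx, hy, hox, hoy, fun k => (hproj k).1, fun k => (hproj k).2,
    fun u hu h => mem_orthogonal_of_card_eq hx hy hox hoy (fun k => (hproj k).1) hcard hu h,
    fun v hv h => mem_orthogonal_of_card_eq hy hx hoy hox (fun k => (hproj k).2) hcard.symm hv h⟩

end PrincipalVectors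

theorem posSingularValues_sortedGE {E F : Type*}
    [NormedAddCommGroup E] [InnerProductSpace ℂ E] [FiniteDimensional ℂ E]
    [NormedAddCommGroup F] [InnerProductSpace ℂ F] [FiniteDimensional ℂ F]
    (T : E →ₗ[ℂ] F) : (posSingularValues T).Pairwise (· ≥ ·) := by
  apply List.Pairwise.filter
  rw [List.pairwise_map]
  exact List.pairwise_lt_range.imp fun h => T.singularValues_antitone h.le

theorem count_map_univ {ι α : Type*} [Fintype ι] [DecidableEq α] (f : ι → α) (a : α) :
    (Finset.univ.val.map f).count a = Nat.card {k // f k = a} := by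
  rw [Multiset.count_map, Nat.card_eq_fintype_card, Fintype.card_subtype, ← Finset.filter_val,
    Finset.card_val]
  simp only [eq_comm]

end PABS

/-! ### Counting the endpoints and comparing the lists -/

theorem theorem4p1 (n : ℕ) (X Y : Submodule ℂ (EuclideanSpace ℂ (Fin n)))
    (θ : Fin (min (Module.finrank ℂ X) (Module.finrank ℂ Y)) → ℝ)
    (hθ : PABS.IsPrincipalAngles X Y θ) :
    (List.ofFn fun k => PABS.extTan (θ k)).reverse =
      List.replicate
          (min (Module.finrank ℂ (Xᗮ ⊓ Y : Submodule ℂ (EuclideanSpace ℂ (Fin n))))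
            (Module.finrank ℂ (X ⊓ Yᗮ : Submodule ℂ (EuclideanSpace ℂ (Fin n))))) (⊤ : EReal) ++
        (PABS.posSingularValues
            (PABS.proj Xᗮ ∘ₗ PABS.pinv (PABS.proj X ∘ₗ PABS.proj Y))).map
          (fun s : ℝ => (s : EReal)) ++
        List.replicate
          (Module.finrank ℂ (X ⊓ Y : Submodule ℂ (EuclideanSpace ℂ (Fin n)))) (0 : EReal) := by
  have hmono := hθ.monotone
  obtain ⟨x, y, h⟩ := hθ
  have hpi := Real.pi_pos
  have hIcc : ∀ k, θ k ∈ Set.Icc 0 (Real.pi / 2) := fun k => (h k).1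
  have hcos : ∀ k, Real.cos (θ k) = ‖inner ℂ (x k) (y k)‖ := fun k => (h k).2.2.1
  have hsys : PABS.IsPrincipalSystem X Y x y :=
    PABS.isPrincipalSystem_of_isMax (fun k => (h k).2.1) fun k p hp =>
      ((h k).2.2.2 p hp).trans (hcos k).le
  have hzero : (Finset.univ.val.map θ).count 0 =
      Module.finrank ℂ (X ⊓ Y : Submodule ℂ (EuclideanSpace ℂ (Fin n))) := by
    rw [PABS.count_map_univ, hsys.finrank_inf_eq]
    refine Nat.card_congr (Equiv.subtypeEquivRight fun k => ?_)
    rw [← hcos]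
    constructor
    · intro h0
      rw [h0, Real.cos_zero]
    · intro h1
      exact Real.injOn_cos ⟨(hIcc k).1, by linarith [(hIcc k).2]⟩ ⟨le_rfl, hpi.le⟩
        (h1.trans Real.cos_zero.symm)
  have htop : (Finset.univ.val.map θ).count (Real.pi / 2) =
      min (Module.finrank ℂ (Xᗮ ⊓ Y : Submodule ℂ (EuclideanSpace ℂ (Fin n))))
        (Module.finrank ℂ (X ⊓ Yᗮ : Submodule ℂ (EuclideanSpace ℂ (Fin n)))) := by
    have hiff : ∀ k, θ k = Real.pi / 2 ↔ inner ℂ (x k) (y k) = 0 := by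
      intro k
      rw [← norm_eq_zero, ← hcos]
      constructor
      · intro h0
        rw [h0, Real.cos_pi_div_two]
      · intro h1
        exact Real.injOn_cos ⟨(hIcc k).1, by linarith [(hIcc k).2]⟩ ⟨by linarith, by linarith⟩
          (h1.trans Real.cos_pi_div_two.symm)
    rw [PABS.count_map_univ, Nat.card_congr (Equiv.subtypeEquivRight hiff)]
    have hX := hsys.finrank_left_eq
    have hY := hsys.symm.finrank_left_eq
    rw [Nat.card_congr (Equiv.subtypeEquivRight fun k => not_congr inner_eq_zero_symm),
      inf_comm Y Xᗮ] at hY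
    change _ = Nat.card {k // inner ℂ (x k) (y k) ≠ 0} + _ at hY
    have hcompl : Nat.card {k // inner ℂ (x k) (y k) = 0} +
        Nat.card {k // inner ℂ (x k) (y k) ≠ 0} =
          min (Module.finrank ℂ X) (Module.finrank ℂ Y) := by
      classical
      rw [← Nat.card_sum, Nat.card_congr (Equiv.sumCompl _), Nat.card_eq_fintype_card,
        Fintype.card_fin]
    -- If `r` of the `s_k` are nonzero, the two intersections have dimensions `dim Y - r` and `dim X
    -- - r`, with minimum `m - r`.
    omega
  have hperm := PABS.map_extTan_eq (Finset.univ.val.map θ) (by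
    intro a ha
    obtain ⟨k, -, rfl⟩ := Multiset.mem_map.mp ha
    exact hIcc k)
  rw [htop, hzero, Multiset.map_map, Multiset.map_map] at hperm
  have hpos := hsys.coe_posSingularValues hIcc hcos
  -- Both lists are decreasing, so equality as multisets suffices.
  refine List.Perm.eq_of_pairwise' (r := (· ≥ ·)) ?_ ?_ ?_
  · rw [List.pairwise_reverse, List.pairwise_ofFn]
    exact fun i j hij => PABS.extTan_monotoneOn (hIcc i) (hIcc j) (hmono hij.le)
  · have hge : ∀ a ∈ (PABS.posSingularValues
        (PABS.proj Xᗮ ∘ₗ PABS.pinv (PABS.proj X ∘ₗ PABS.proj Y))).map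
          (fun s : ℝ => (s : EReal)), 0 ≤ a := by
      intro a ha
      obtain ⟨s, hs, rfl⟩ := List.mem_map.mp ha
      exact EReal.coe_nonneg.mpr (of_decide_eq_true (List.mem_filter.mp hs).2).le
    rw [List.pairwise_append, List.pairwise_append]
    refine ⟨⟨List.pairwise_replicate_of_refl, ?_, ?_⟩, List.pairwise_replicate_of_refl, ?_⟩
    · rw [List.pairwise_map]
      exact (PABS.posSingularValues_sortedGE _).imp fun hab => EReal.coe_le_coe_iff.mpr hab
    · intro a ha b _
      rw [List.eq_of_mem_replicate ha]
      exact le_top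
    · intro a ha b hb
      rw [List.eq_of_mem_replicate hb]
      rcases List.mem_append.mp ha with ha | ha
      · rw [List.eq_of_mem_replicate ha]
        exact le_top
      · exact hge a ha
  · rw [← Multiset.coe_eq_coe, Multiset.coe_reverse, ← Multiset.coe_add, ← Multiset.coe_add,
      Multiset.coe_replicate, Multiset.coe_replicate, ← Multiset.map_coe, hpos, ← Fin.univ_val_map]
    exact hperm
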